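/- Let $\mathbb{X}$ be a reflexive real Banach space and $\mathbb{Y}$ an arbitrary real Banach space. Write $\mathbb{L}(\mathbb{X},\mathbb{Y})$ for the space of bounded linear operators from $\mathbb{X}$ to $\mathbb{Y}$ with the operator norm, and $\mathbb{K}(\mathbb{X},\mathbb{Y})$ for its subspace of compact operators. A unit vector $u$ of a real Banach space $\mathbb{E}$ is called $k$-smooth ($k\in\mathbb{N}$) if $\dim\operatorname{span}J(u)=k$, where $J(u)=\{f\in\mathbb{E}^*:\|f\|=1,\ f(u)=1\}$; for a norm-one operator $T$ this is applied with $\mathbb{E}=\mathbb{L}(\mathbb{X},\mathbb{Y})$. A subspace $M$ of $\mathbb{E}$ is called an M-ideal in $\mathbb{E}$ if there is a linear projection $P$ on $\mathbb{E}^*$ with range $\{f\in\mathbb{E}^*: f(m)=0 \text{ for all } m\in M\}$ such that $\|f\|=\|Pf\|+\|f-Pf\|$ for all $f\in\mathbb{E}^*$. For $T\in\mathbb{L}(\mathbb{X},\mathbb{Y})$ put $M_T=\{x\in\mathbb{X}:\|x\|=1,\ \|Tx\|=\|T\|\}$, and let $\operatorname{Ext}(B_{\mathbb{X}})$ be the set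 of extreme points of the closed unit ball of $\mathbb{X}$. Suppose that $\mathbb{K}(\mathbb{X},\mathbb{Y})$ is an M-ideal in $\mathbb{L}(\mathbb{X},\mathbb{Y})$. Let $T\in\mathbb{L}(\mathbb{X},\mathbb{Y})$ satisfy $\|T\|=1$ and $\operatorname{dist}(T,\mathbb{K}(\mathbb{X},\mathbb{Y}))<1$, and suppose that $$M_T\cap\operatorname{Ext}(B_{\mathbb{X}})=\{\pm x_1,\pm x_2,\dots,\pm x_r\},$$ where $x_1,\dots,x_r$ are linearly independent in $\mathbb{X}$. Suppose that $Tx_i$ is $m_i$-smooth for each $1\le i\le r$. Then $T$ is $k$-smooth, where $k=m_1+m_2+\dots+m_r$. -/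

import Mathlib

/-- A real normed space is reflexive if the canonical map into its bidual is onto. -/
def IsReflexiveSpace (E : Type*) [NormedAddCommGroup E] [NormedSpace ℝ E] : Prop :=
  Function.Surjective (NormedSpace.inclusionInDoubleDual ℝ E)

/-- `J(x)`: the norm-one continuous functionals `f` with `f x = 1`. -/
def supportFunctionals {E : Type*} [NormedAddCommGroup E] [NormedSpace ℝ E] (x : E) :
    Set (StrongDual ℝ E) :=
  {f | ‖f‖ = 1 ∧ f x = 1}

/-- `x` is `k`-smooth: it is a unit vector and the span of `J(x)` has dimension exactly `k`.
The dimension is the cardinal-valued rank, so an infinite-dimensional span is not `k`-smooth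
for any natural number `k`. -/
def IsKSmooth {E : Type*} [NormedAddCommGroup E] [NormedSpace ℝ E] (k : ℕ) (x : E) : Prop :=
  ‖x‖ = 1 ∧ Module.rank ℝ (Submodule.span ℝ (supportFunctionals x)) = (k : Cardinal)

/-- `M_T`: the unit vectors at which `T` attains its norm. -/
def normAttainmentSet {E F : Type*} [NormedAddCommGroup E] [NormedSpace ℝ E]
    [NormedAddCommGroup F] [NormedSpace ℝ F] (T : E →L[ℝ] F) : Set E :=
  {x | ‖x‖ = 1 ∧ ‖T x‖ = ‖T‖}

/-- `M` is an M-ideal in `E`: there is a projection `P` on the dual of `E` whose range is the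
annihilator of `M` and with `‖f‖ = ‖P f‖ + ‖f - P f‖` for all `f`. -/
def IsMIdeal {E : Type*} [NormedAddCommGroup E] [NormedSpace ℝ E] (M : Submodule ℝ E) : Prop :=
  ∃ P : StrongDual ℝ E →L[ℝ] StrongDual ℝ E,
    IsLprojection (StrongDual ℝ E) P ∧
      Set.range P = {f : StrongDual ℝ E | ∀ m ∈ M, f m = 0}

/-- The subspace `K(E, F)` of compact operators in the space `L(E, F)` of bounded operators. -/
def compactOperators (E F : Type*) [NormedAddCommGroup E] [NormedSpace ℝ E]
    [NormedAddCommGroup F] [NormedSpace ℝ F] : Submodule ℝ (E →L[ℝ] F) :=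
  compactOperator (RingHom.id ℝ) E F

/-! `J(T)` is a weak-star compact face of the dual ball of `L(X,Y)`, so its extreme points are
extreme in that ball. Such an extreme `f` annihilates `K(X,Y)` or lies in the kernel of the
L-projection; the first is excluded by `f T = 1` and `dist(T, K) < 1`. In the second case `f`
restricts to an extreme functional on `K(X,Y)`. Milman's converse, with reflexivity, writes the
restriction as `k ↦ y (k x)`, and uniqueness of norm-preserving extensions carries this formula to
all of `L(X,Y)`. Extremality passes to `x`, so `x = ±x_i`.

By Krein-Milman, `span J(T)` is therefore the sum of the images of `span J(T x_i)` under `y ↦ (S ↦ y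
(S x_i))`. Testing on rank-one operators built from functionals biorthogonal to the `x_i` shows that
these maps are jointly injective, so the dimensions add. -/

open Set Topology

/-! ### Convex joins and Milman's converse. -/

section ConvexHull

variable {E : Type*} [AddCommGroup E] [Module ℝ E] [TopologicalSpace E]

theorem isCompact_convexJoin [IsTopologicalAddGroup E] [ContinuousSMul ℝ E] {s t : Set E}
    (hs : IsCompact s) (ht : IsCompact t) : IsCompact (convexJoin ℝ s t) := by
  have h : convexJoin ℝ s t =
      (fun p : ℝ × E × E => (1 - p.1) • p.2.1 + p.1 • p.2.2) '' (Icc (0 : ℝ) 1 ×ˢ s ×ˢ t) := by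
    ext z
    simp only [mem_convexJoin, segment_eq_image, mem_image, mem_prod, Prod.exists]
    constructor
    · rintro ⟨a, ha, b, hb, θ, hθ, rfl⟩
      exact ⟨θ, a, b, ⟨hθ, ha, hb⟩, rfl⟩
    · rintro ⟨θ, a, b, ⟨hθ, ha, hb⟩, rfl⟩
      exact ⟨a, ha, b, hb, θ, hθ, rfl⟩
  rw [h]
  exact (isCompact_Icc.prod (hs.prod ht)).image (by fun_prop)

variable [T2Space E] [IsTopologicalAddGroup E] [ContinuousSMul ℝ E]

/-- An extreme point of a compact convex set lying in the closed convex hull of a finite union of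
subsets lies in the closed convex hull of one of these subsets. -/
theorem mem_closure_convexHull_of_mem_extremePoints_biUnion {ι : Type*} {C : Set E}
    (hC : IsCompact C) (hconv : Convex ℝ C) {f : E} (hf : f ∈ C.extremePoints ℝ) (u : Finset ι)
    (A : ι → Set E) (hA : ∀ i, A i ⊆ C)
    (hfu : f ∈ closure (convexHull ℝ (⋃ i ∈ u, A i))) :
    ∃ i ∈ u, f ∈ closure (convexHull ℝ (A i)) := by
  classical
  induction u using Finset.induction_on with
  | empty => simp at hfu
  | insert i u _ ih =>
    rw [Finset.set_biUnion_insert] at hfu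
    set B := ⋃ j ∈ u, A j with hB
    have hBC : B ⊆ C := iUnion₂_subset fun j _ => hA j
    have hcl : ∀ D ⊆ C, closure (convexHull ℝ D) ⊆ C := fun D hD =>
      closure_minimal (convexHull_min hD hconv) hC.isClosed
    have hcomp : ∀ D ⊆ C, IsCompact (closure (convexHull ℝ D)) := fun D hD =>
      hC.of_isClosed_subset isClosed_closure (hcl D hD)
    rcases (A i).eq_empty_or_nonempty with hi | hi
    · rw [hi, empty_union] at hfu
      obtain ⟨j, hj, hfj⟩ := ih hfu
      exact ⟨j, Finset.mem_insert_of_mem hj, hfj⟩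
    rcases B.eq_empty_or_nonempty with hBe | hBn
    · rw [hBe, union_empty] at hfu
      exact ⟨i, Finset.mem_insert_self i u, hfu⟩
    have hne : ∀ D : Set E, D.Nonempty → (closure (convexHull ℝ D)).Nonempty := fun D hD =>
      (hD.mono (subset_convexHull ℝ D)).closure
    have hsub : ∀ D : Set E, D ⊆ closure (convexHull ℝ D) := fun D =>
      (subset_convexHull ℝ D).trans subset_closure
    -- The join of two compact convex sets is convex and closed, so no further closure is needed and
    -- `f` lies on a segment between the two hulls.
    have hjoin : closure (convexHull ℝ (A i ∪ B)) ⊆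
        convexJoin ℝ (closure (convexHull ℝ (A i))) (closure (convexHull ℝ B)) := by
      refine closure_minimal (convexHull_min (union_subset ?_ ?_) ?_)
        (isCompact_convexJoin (hcomp _ (hA i)) (hcomp _ hBC)).isClosed
      · exact (hsub _).trans (subset_convexJoin_left (hne _ hBn))
      · exact (hsub _).trans (subset_convexJoin_right (hne _ hi))
      · exact (convex_convexHull ℝ _).closure.convexJoin (convex_convexHull ℝ _).closure
    obtain ⟨p, hp, q, hq, hpq⟩ := mem_convexJoin.1 (hjoin hfu)
    rcases (mem_extremePoints_iff_forall_segment.1 hf).2 p (hcl _ (hA i) hp) q (hcl _ hBC hq) hpq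
      with rfl | rfl
    · exact ⟨i, Finset.mem_insert_self i u, hp⟩
    · obtain ⟨j, hj, hfj⟩ := ih hq
      exact ⟨j, Finset.mem_insert_of_mem hj, hfj⟩

/-- **Milman's converse** to the Krein-Milman theorem: if `A` is a compact subset of a compact
convex set `C`, then every extreme point of `C` in the closed convex hull of `A` lies in `A`. -/
theorem mem_of_mem_extremePoints_of_mem_closure_convexHull [LocallyConvexSpace ℝ E] {A C : Set E}
    (hA : IsCompact A) (hC : IsCompact C) (hconv : Convex ℝ C) (hAC : A ⊆ C) {f : E}
    (hf : f ∈ C.extremePoints ℝ) (hfA : f ∈ closure (convexHull ℝ A)) : f ∈ A := by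
  by_contra hnot
  -- Closed half-spaces cut halfway between `a` and `f`; compactness of `A` leaves finitely many
  -- pieces, each with closed hull missing `f`.
  have hsep : ∀ a ∈ A, ∃ V ∈ 𝓝 a, IsClosed V ∧ Convex ℝ V ∧ f ∉ V := by
    intro a ha
    obtain ⟨l, hl⟩ := geometric_hahn_banach_point_point (E := E) (x := a) (y := f)
      (fun h => hnot (h ▸ ha))
    refine ⟨{z | l z ≤ (l a + l f) / 2}, ?_, isClosed_le l.continuous continuous_const,
      convex_halfSpace_le l.toLinearMap.isLinear _, ?_⟩
    · filter_upwards [l.continuous.continuousAt.eventually (gt_mem_nhds (by linarith :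
        l a < (l a + l f) / 2))] with z hz using hz.le
    · simp only [mem_ofPred_eq, not_le]
      linarith
  choose! V hV hVcl hVconv hfV using hsep
  obtain ⟨u, huA, hu⟩ := hA.elim_nhds_subcover V hV
  have hcover : A ⊆ ⋃ a ∈ u, A ∩ V a := fun z hz => by
    obtain ⟨a, ha, hza⟩ := mem_iUnion₂.1 (hu hz)
    exact mem_iUnion₂.2 ⟨a, ha, hz, hza⟩
  obtain ⟨a, ha, hfa⟩ := mem_closure_convexHull_of_mem_extremePoints_biUnion hC hconv hf u
    (fun a => A ∩ V a) (fun a => inter_subset_left.trans hAC)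
    (closure_mono (convexHull_mono hcover) hfA)
  exact hfV a (huA a ha) (closure_minimal (convexHull_min inter_subset_right
    (hVconv a (huA a ha))) (hVcl a (huA a ha)) hfa)

end ConvexHull

/-! ### Weak-star topology and support functionals. -/

section WeakStar

variable {E : Type*} [NormedAddCommGroup E] [NormedSpace ℝ E]

instance WeakDual.locallyConvexSpace : LocallyConvexSpace ℝ (WeakDual ℝ E) :=
  inferInstanceAs (LocallyConvexSpace ℝ (WeakBilin (topDualPairing ℝ E)))

theorem WeakDual.exists_eq_eval (l : StrongDual ℝ (WeakDual ℝ E)) :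
    ∃ x : E, ∀ f : WeakDual ℝ E, l f = f x := by
  obtain ⟨x, hx⟩ := LinearMap.dualEmbedding_surjective (topDualPairing ℝ E) l
  exact ⟨x, fun f => by rw [← hx]; rfl⟩

/-- A set of functionals that norms the space from above contains the whole dual
unit ball in its weak-star closed convex hull. -/
theorem WeakDual.mem_closure_convexHull_of_norming {A : Set (WeakDual ℝ E)}
    (hA : ∀ (x : E) (u : ℝ), (∀ g ∈ A, g x ≤ u) → ‖x‖ ≤ u) {f : WeakDual ℝ E}
    (hf : ‖WeakDual.toStrongDual f‖ ≤ 1) : f ∈ closure (convexHull ℝ A) := by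
  by_contra hnot
  obtain ⟨l, u, hlu, hul⟩ := geometric_hahn_banach_closed_point
    (convex_convexHull ℝ A).closure isClosed_closure hnot
  obtain ⟨x, hx⟩ := WeakDual.exists_eq_eval l
  have h1 : ‖x‖ ≤ u := hA x u fun g hg => by
    rw [← hx]
    exact (hlu g (subset_closure (subset_convexHull ℝ A hg))).le
  have h2 : f x ≤ ‖x‖ := by
    have := (WeakDual.toStrongDual f).le_of_opNorm_le hf x
    rw [one_mul] at this
    exact (le_abs_self _).trans this
  rw [hx] at hul
  linarith

/-- If the extreme points of a weak-star compact convex set of functionals lie in a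
finite-dimensional subspace, then so does the whole set. -/
theorem subset_of_extremePoints_subset_of_finiteDimensional {S : Set (StrongDual ℝ E)}
    (hS : IsCompact (WeakDual.toStrongDual ⁻¹' S : Set (WeakDual ℝ E))) (hconv : Convex ℝ S)
    (V : Submodule ℝ (StrongDual ℝ E)) [FiniteDimensional ℝ V]
    (hV : S.extremePoints ℝ ⊆ V) : S ⊆ V := by
  let e : WeakDual ℝ E ≃ₗ[ℝ] StrongDual ℝ E := WeakDual.toStrongDual
  let V' : Submodule ℝ (WeakDual ℝ E) := V.map e.symm.toLinearMap
  -- Finite dimension gives weak-star closedness, which keeps the closed hull from Krein-Milman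
  -- inside `V`.
  have hcl : IsClosed (V' : Set (WeakDual ℝ E)) := V'.closed_of_finiteDimensional
  have hconv' : Convex ℝ (e ⁻¹' S) := hconv.linear_preimage e.toLinearMap
  have hext : (e ⁻¹' S).extremePoints ℝ ⊆ V' := by
    intro f hf
    have : e f ∈ S.extremePoints ℝ := by
      have h := image_extremePoints e (e ⁻¹' S)
      rw [image_preimage_eq _ e.surjective] at h
      exact h ▸ mem_image_of_mem e hf
    exact ⟨e f, hV this, e.symm_apply_apply f⟩
  have hKM := closure_convexHull_extremePoints hS hconv'
  intro f hf
  have hf' : e.symm f ∈ closure (convexHull ℝ ((e ⁻¹' S).extremePoints ℝ)) := by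
    rw [hKM]
    exact hf
  obtain ⟨g, hg, hgf⟩ := closure_minimal (convexHull_min hext V'.convex) hcl hf'
  rwa [← e.symm.injective hgf]

variable (E) in
/-- The dual unit ball of `E`, as a set in the weak dual. -/
def WeakDual.unitBall : Set (WeakDual ℝ E) :=
  {f | ‖WeakDual.toStrongDual f‖ ≤ 1}

theorem WeakDual.unitBall_eq_preimage_closedBall :
    WeakDual.unitBall E = WeakDual.toStrongDual ⁻¹' Metric.closedBall (0 : StrongDual ℝ E) 1 := by
  ext f
  exact mem_closedBall_zero_iff.symm

theorem WeakDual.isCompact_unitBall : IsCompact (WeakDual.unitBall E) := by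
  rw [WeakDual.unitBall_eq_preimage_closedBall]
  exact WeakDual.isCompact_closedBall 0 1

theorem WeakDual.convex_unitBall : Convex ℝ (WeakDual.unitBall E) := by
  rw [WeakDual.unitBall_eq_preimage_closedBall]
  exact (convex_closedBall (0 : StrongDual ℝ E) 1).linear_preimage WeakDual.toStrongDual.toLinearMap

/-- Since `f x = 1` forces `1 ≤ ‖f‖`, the condition `‖f‖ = 1` relaxes to `‖f‖ ≤ 1`, leaving a closed
slice of the Banach-Alaoglu ball. -/
theorem isCompact_supportFunctionals {x : E} (hx : ‖x‖ = 1) :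
    IsCompact (WeakDual.toStrongDual ⁻¹' supportFunctionals x : Set (WeakDual ℝ E)) := by
  have h : (WeakDual.toStrongDual ⁻¹' supportFunctionals x : Set (WeakDual ℝ E)) =
      WeakDual.unitBall E ∩ {f | f x = 1} := by
    ext f
    simp only [supportFunctionals, WeakDual.unitBall, mem_preimage, mem_ofPred_eq, mem_inter_iff,
      WeakDual.toStrongDual_apply]
    refine and_congr_left fun h => ⟨le_of_eq, fun h1 => h1.antisymm ?_⟩
    have := (WeakDual.toStrongDual f).le_opNorm x
    rw [hx, mul_one, WeakDual.toStrongDual_apply, h] at this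
    simpa using this
  rw [h]
  exact WeakDual.isCompact_unitBall.inter_right
    (isClosed_eq (WeakDual.eval_continuous x) continuous_const)

theorem StrongDual.mem_closedBall_zero_one {f : StrongDual ℝ E} :
    f ∈ Metric.closedBall (0 : StrongDual ℝ E) 1 ↔ ‖f‖ ≤ 1 :=
  mem_closedBall_zero_iff

theorem finiteDimensional_of_rank_eq_natCast {V : Type*} [AddCommGroup V] [Module ℝ V] {k : ℕ}
    (h : Module.rank ℝ V = k) : FiniteDimensional ℝ V :=
  Module.rank_lt_aleph0_iff.1 (h.trans_lt Cardinal.natCast_lt_aleph0)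

theorem mem_supportFunctionals_iff {x : E} (hx : ‖x‖ ≤ 1) {f : StrongDual ℝ E} :
    f ∈ supportFunctionals x ↔ ‖f‖ ≤ 1 ∧ f x = 1 := by
  refine and_congr_left fun h => ⟨le_of_eq, fun h1 => h1.antisymm ?_⟩
  have := f.le_of_opNorm_le_of_le le_rfl hx
  rw [h] at this
  simpa using this

theorem convex_supportFunctionals {x : E} (hx : ‖x‖ ≤ 1) : Convex ℝ (supportFunctionals x) := by
  intro f hf g hg a b ha hb hab
  rw [mem_supportFunctionals_iff hx] at *
  refine ⟨?_, by simp [hf.2, hg.2, hab]⟩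
  have := convex_closedBall (0 : StrongDual ℝ E) 1 (x := f) (y := g) (by simpa using hf.1)
    (by simpa using hg.1) ha hb hab
  simpa using this

/-- The support functionals of a vector form a face of the dual unit ball. -/
theorem extremePoints_supportFunctionals_subset {x : E} (hx : ‖x‖ ≤ 1) :
    (supportFunctionals x).extremePoints ℝ ⊆
      (Metric.closedBall (0 : StrongDual ℝ E) 1).extremePoints ℝ := by
  have hle : ∀ g ∈ Metric.closedBall (0 : StrongDual ℝ E) 1, g x ≤ 1 := fun g hg => by
    have := g.le_of_opNorm_le_of_le (mem_closedBall_zero_iff.1 hg) hx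
    rw [one_mul] at this
    exact (le_abs_self _).trans this
  have hface : IsExtreme ℝ (Metric.closedBall (0 : StrongDual ℝ E) 1) (supportFunctionals x) := by
    refine ⟨fun f hf => by simpa using hf.1.le, ?_⟩
    rintro g hg h hh f hf ⟨a, b, ha, hb, hab, rfl⟩
    refine (mem_supportFunctionals_iff hx).2 ⟨by simpa using hg, ?_⟩
    have h1 : a * g x + b * h x = 1 := hf.2
    nlinarith [hle g hg, hle h hh]
  exact hface.extremePoints_subset_extremePoints

end WeakStar

/-! ### Extreme functionals on spaces of compact operators. -/

section CompactDual

variable {X Y : Type*} [NormedAddCommGroup X] [NormedSpace ℝ X]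
  [NormedAddCommGroup Y] [NormedSpace ℝ Y]

/-- The adjoint of a compact operator is weak-star to norm continuous on the dual unit ball. -/
theorem IsCompactOperator.continuousOn_dual_comp {k : X →L[ℝ] Y} (hk : IsCompactOperator k) :
    ContinuousOn (fun y : WeakDual ℝ Y => (WeakDual.toStrongDual y).comp k)
      (WeakDual.unitBall Y) := by
  intro y₀ hy₀
  rw [ContinuousWithinAt, Metric.tendsto_nhds]
  intro ε hε
  have hcomp : IsCompact (closure ((k : X →ₗ[ℝ] Y) '' Metric.closedBall 0 1)) :=
    IsCompactOperator.isCompact_closure_image_closedBall (f := (k : X →ₗ[ℝ] Y)) hk 1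
  -- Closeness on a finite `ε / 8`-net suffices: the difference `d` has norm at most `2`, so the
  -- error is at most `2 * (ε / 8) + ε / 8 < ε / 2`.
  obtain ⟨t, htfin, ht⟩ := Metric.totallyBounded_iff.1 hcomp.totallyBounded (ε / 8) (by positivity)
  have hev : ∀ᶠ y : WeakDual ℝ Y in 𝓝 y₀, ∀ c ∈ t, dist (y c) (y₀ c) < ε / 8 :=
    (Filter.eventually_all_finite htfin).2 fun c _ =>
      (WeakDual.eval_continuous c).continuousAt.eventually
        (Metric.ball_mem_nhds (y₀ c) (by positivity : 0 < ε / 8))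
  filter_upwards [nhdsWithin_le_nhds hev, self_mem_nhdsWithin] with y hyt hy
  rw [dist_eq_norm, ← ContinuousLinearMap.sub_comp]
  set d : StrongDual ℝ Y := WeakDual.toStrongDual y - WeakDual.toStrongDual y₀ with hd
  have hdn : ‖d‖ ≤ 2 := (norm_sub_le _ _).trans (by
    have h1 : ‖WeakDual.toStrongDual y‖ ≤ 1 := hy
    have h2 : ‖WeakDual.toStrongDual y₀‖ ≤ 1 := hy₀
    linarith)
  refine lt_of_le_of_lt (ContinuousLinearMap.opNorm_le_of_unit_norm
    (C := ε / 2) (by positivity) fun x hx => ?_) (by linarith)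
  have hkx : k x ∈ closure ((k : X →ₗ[ℝ] Y) '' Metric.closedBall 0 1) :=
    subset_closure ⟨x, by simp [hx], rfl⟩
  obtain ⟨c, hc, hkc⟩ := mem_iUnion₂.1 (ht hkx)
  have h1 : ‖d (k x - c)‖ ≤ 2 * (ε / 8) :=
    d.le_of_opNorm_le_of_le hdn (by rw [← dist_eq_norm]; exact hkc.le)
  have h2 : ‖d c‖ < ε / 8 := by
    have := hyt c hc
    rwa [dist_eq_norm] at this
  calc ‖(d.comp k) x‖ = ‖d (k x - c) + d c‖ := by simp
    _ ≤ ‖d (k x - c)‖ + ‖d c‖ := norm_add_le _ _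
    _ ≤ ε / 2 := by linarith

variable {Z : Type*} [NormedAddCommGroup Z] [NormedSpace ℝ Z]

/-- The functionals `k ↦ φ (y ∘ k)` on a space `Z` of operators, with `φ` in the bidual unit
ball and `y` in the dual unit ball. The space is given by an isometric embedding `j`. -/
def tensorFunctionals (j : Z →ₗᵢ[ℝ] X →L[ℝ] Y) : Set (WeakDual ℝ Z) :=
  {g | ∃ φ : StrongDual ℝ (StrongDual ℝ X), ∃ y : StrongDual ℝ Y, ‖φ‖ ≤ 1 ∧ ‖y‖ ≤ 1 ∧
    ∀ k, g k = φ (y.comp (j k))}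

/-- Compactness of each `j k` makes `(φ, y) ↦ φ (y ∘ j k)` jointly weak-star continuous on the
product of balls. Bidual elements `φ` are used because their ball is weak-star compact. -/
theorem isCompact_tensorFunctionals {j : Z →ₗᵢ[ℝ] X →L[ℝ] Y}
    (hj : ∀ k, IsCompactOperator (j k)) : IsCompact (tensorFunctionals j) := by
  let F : WeakDual ℝ (StrongDual ℝ X) × WeakDual ℝ Y → WeakDual ℝ Z :=
    fun p => StrongDual.toWeakDual ((WeakDual.toStrongDual p.1).comp
      ((ContinuousLinearMap.compL ℝ X Y ℝ (WeakDual.toStrongDual p.2)).comp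
        j.toContinuousLinearMap))
  have hF : ∀ p (k : Z), F p k =
      WeakDual.toStrongDual p.1 ((WeakDual.toStrongDual p.2).comp (j k)) :=
    fun _ _ => rfl
  have himage : tensorFunctionals j = F '' (WeakDual.unitBall (StrongDual ℝ X) ×ˢ WeakDual.unitBall Y) := by
    ext g
    constructor
    · rintro ⟨φ, y, hφ, hy, hg⟩
      exact ⟨(StrongDual.toWeakDual φ, StrongDual.toWeakDual y), ⟨hφ, hy⟩,
        DFunLike.ext _ _ fun k => (hg k).symm⟩
    · rintro ⟨p, ⟨h1, h2⟩, rfl⟩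
      exact ⟨WeakDual.toStrongDual p.1, WeakDual.toStrongDual p.2, h1,
        h2, fun k => rfl⟩
  rw [himage]
  refine (WeakDual.isCompact_unitBall.prod WeakDual.isCompact_unitBall).image_of_continuousOn ?_
  rw [continuousOn_iff_continuous_domRestrict]
  refine WeakDual.continuous_of_continuous_eval fun k => ?_
  change Continuous ((WeakDual.unitBall (StrongDual ℝ X) ×ˢ WeakDual.unitBall Y).domRestrict fun p => F p k)
  rw [← continuousOn_iff_continuous_domRestrict]
  rintro ⟨φ₀, y₀⟩ ⟨hφ₀, hy₀⟩
  set ψ : WeakDual ℝ Y → StrongDual ℝ X :=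
    fun y => (WeakDual.toStrongDual y).comp (j k) with hψ
  have hψc : Filter.Tendsto (fun p : WeakDual ℝ (StrongDual ℝ X) × WeakDual ℝ Y => ψ p.2)
      (𝓝[WeakDual.unitBall (StrongDual ℝ X) ×ˢ WeakDual.unitBall Y] (φ₀, y₀)) (𝓝 (ψ y₀)) := by
    refine (IsCompactOperator.continuousOn_dual_comp (hj k) y₀ hy₀).tendsto.comp ?_
    exact tendsto_nhdsWithin_iff.2 ⟨continuous_snd.continuousAt.tendsto.mono_left
      nhdsWithin_le_nhds, by filter_upwards [self_mem_nhdsWithin] with p hp using hp.2⟩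
  -- Split `φ (ψ y)` as `φ (ψ y - ψ y₀) + φ (ψ y₀)`: the first term is small uniformly over `‖φ‖ ≤
  -- 1`, the second converges weak-star.
  have h1 : Filter.Tendsto (fun p : WeakDual ℝ (StrongDual ℝ X) × WeakDual ℝ Y =>
      WeakDual.toStrongDual p.1 (ψ p.2 - ψ y₀)) (𝓝[WeakDual.unitBall (StrongDual ℝ X) ×ˢ WeakDual.unitBall Y] (φ₀, y₀)) (𝓝 0) := by
    refine squeeze_zero_norm' ?_ (tendsto_iff_norm_sub_tendsto_zero.1 hψc)
    filter_upwards [self_mem_nhdsWithin] with p hp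
    have := (WeakDual.toStrongDual p.1).le_of_opNorm_le
      hp.1 (ψ p.2 - ψ y₀)
    rwa [one_mul] at this
  have h2 : Filter.Tendsto (fun p : WeakDual ℝ (StrongDual ℝ X) × WeakDual ℝ Y => p.1 (ψ y₀))
      (𝓝[WeakDual.unitBall (StrongDual ℝ X) ×ˢ WeakDual.unitBall Y] (φ₀, y₀)) (𝓝 (φ₀ (ψ y₀))) :=
    (((WeakDual.eval_continuous (ψ y₀)).comp continuous_fst).continuousAt (x := (φ₀, y₀))).tendsto
      |>.mono_left nhdsWithin_le_nhds
  have h3 := h1.add h2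
  rw [zero_add] at h3
  refine h3.congr fun p => ?_
  rw [hF, ← WeakDual.toStrongDual_apply p.1, ← map_add, sub_add_cancel]

theorem norm_le_of_forall_tensorFunctionals_le (j : Z →ₗᵢ[ℝ] X →L[ℝ] Y) (k : Z) (u : ℝ)
    (h : ∀ g ∈ tensorFunctionals j, g k ≤ u) : ‖k‖ ≤ u := by
  have key : ∀ (x : X) (y : StrongDual ℝ Y), ‖x‖ ≤ 1 → ‖y‖ ≤ 1 → y (j k x) ≤ u := by
    intro x y hx hy
    refine h (StrongDual.toWeakDual (y.comp ((ContinuousLinearMap.apply ℝ Y x).comp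
      j.toContinuousLinearMap))) ⟨NormedSpace.inclusionInDoubleDual ℝ X x, y,
        (NormedSpace.double_dual_bound ℝ X x).trans hx, hy, fun k => rfl⟩
  have hu : 0 ≤ u := by simpa using key 0 0 (by simp) (by simp)
  refine (j.norm_map k).symm.trans_le <|
    ContinuousLinearMap.opNorm_le_of_unit_norm hu fun x hx => ?_
  obtain ⟨y, hy, hyx⟩ := exists_dual_vector'' ℝ (j k x)
  have := key x y hx.le hy
  rw [hyx] at this
  simpa using this

/-- For reflexive `X`, every extreme point of the dual unit ball of a space of compact operators
is of the form `k ↦ y (k x)`. -/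
theorem exists_eq_of_mem_extremePoints_dual_of_isCompactOperator (hX : IsReflexiveSpace X)
    {j : Z →ₗᵢ[ℝ] X →L[ℝ] Y} (hj : ∀ k, IsCompactOperator (j k))
    {f : StrongDual ℝ Z}
    (hf : f ∈ (Metric.closedBall (0 : StrongDual ℝ Z) 1).extremePoints ℝ) :
    ∃ (x : X) (y : StrongDual ℝ Y), ‖x‖ ≤ 1 ∧ ‖y‖ ≤ 1 ∧
      ∀ k, f k = y (j k x) := by
  have hsub : tensorFunctionals j ⊆ WeakDual.unitBall Z := by
    rintro g ⟨φ, y, hφ, hy, hg⟩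
    refine ContinuousLinearMap.opNorm_le_bound _ zero_le_one fun k => ?_
    rw [WeakDual.toStrongDual_apply, hg]
    refine φ.le_of_opNorm_le_of_le hφ ?_
    calc ‖y.comp (j k)‖ ≤ ‖y‖ * ‖(j k)‖ := y.opNorm_comp_le _
      _ ≤ 1 * ‖k‖ := by gcongr; exact (j.norm_map k).le
      _ = ‖k‖ := one_mul _
  have hmem := mem_of_mem_extremePoints_of_mem_closure_convexHull
    (f := StrongDual.toWeakDual f) (isCompact_tensorFunctionals hj)
    WeakDual.isCompact_unitBall WeakDual.convex_unitBall hsub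
    (by rw [WeakDual.unitBall_eq_preimage_closedBall]; exact hf)
    (WeakDual.mem_closure_convexHull_of_norming (norm_le_of_forall_tensorFunctionals_le j)
      (by simpa using hf.1))
  obtain ⟨φ, y, hφ, hy, hg⟩ := hmem
  obtain ⟨x, rfl⟩ := hX φ
  refine ⟨x, y, ?_, hy, fun k => hg k⟩
  rwa [← (NormedSpace.inclusionInDoubleDualLi (E := X) ℝ).norm_map x]

end CompactDual

/-! ### L-projections and M-ideals. -/

section MIdeal

variable {E : Type*} [NormedAddCommGroup E] [NormedSpace ℝ E]

theorem IsLprojection.norm_eq_add {P : E →L[ℝ] E} (hP : IsLprojection E P) (f : E) :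
    ‖f‖ = ‖P f‖ + ‖f - P f‖ :=
  hP.Lnorm f

theorem IsLprojection.apply_apply {P : E →L[ℝ] E} (hP : IsLprojection E P) (f : E) :
    P (P f) = P f :=
  DFunLike.congr_fun hP.proj f

/-- An extreme point of the unit ball lies in the range or in the kernel of any L-projection. -/
theorem IsLprojection.apply_eq_zero_or_eq_self {P : E →L[ℝ] E} (hP : IsLprojection E P) {f : E}
    (hf : f ∈ (Metric.closedBall (0 : E) 1).extremePoints ℝ) (hf1 : ‖f‖ = 1) :
    P f = 0 ∨ P f = f := by
  by_contra! h
  have hs : 0 < ‖P f‖ := norm_pos_iff.2 h.1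
  have ht : 0 < ‖f - P f‖ := norm_pos_iff.2 (sub_ne_zero.2 h.2.symm)
  have hsum : ‖P f‖ + ‖f - P f‖ = 1 := by rw [← hP.norm_eq_add, hf1]
  have hball : ∀ v : E, 0 < ‖v‖ → ‖v‖⁻¹ • v ∈ Metric.closedBall (0 : E) 1 := fun v hv => by
    simp [norm_smul, inv_mul_cancel₀ hv.ne']
  -- `f` is the convex combination of the normalised `P f` and `f - P f`, weighted by their norms.
  have hEq : ‖P f‖⁻¹ • P f = f := hf.2 (hball _ hs) (hball _ ht)
    ⟨‖P f‖, ‖f - P f‖, hs, ht, hsum, by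
      rw [smul_inv_smul₀ hs.ne', smul_inv_smul₀ ht.ne', add_sub_cancel]⟩
  apply h.2
  conv_lhs => rw [← hEq, map_smul, hP.apply_apply, hEq]

/-- If an L-projection on the dual has the annihilator of `M` as its range, then functionals in its
kernel are determined by their restrictions to `M`, among functionals of no larger norm. -/
theorem IsLprojection.eq_of_eqOn {M : Submodule ℝ E} {P : StrongDual ℝ E →L[ℝ] StrongDual ℝ E}
    (hP : IsLprojection (StrongDual ℝ E) P)
    (hrange : Set.range P = {f : StrongDual ℝ E | ∀ m ∈ M, f m = 0})
    {f h : StrongDual ℝ E} (hf : P f = 0) (hh : ‖h‖ ≤ ‖f‖) (hfh : ∀ m ∈ M, h m = f m) :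
    h = f := by
  -- `P` fixes `h - f` and kills `f`, so `P h = h - f` and `‖h‖ = ‖h - f‖ + ‖f‖`.
  have hmem : h - f ∈ Set.range P := by
    rw [hrange]
    intro m hm
    simp [hfh m hm]
  obtain ⟨g, hg⟩ := hmem
  have hPh : P h = h - f := by
    have := hP.apply_apply g
    rw [hg, map_sub, hf, sub_zero] at this
    exact this
  have := hP.norm_eq_add h
  rw [hPh, sub_sub_cancel] at this
  exact sub_eq_zero.1 (norm_le_zero_iff.1 (by linarith))

/-- Restricting an extreme functional in the kernel of the L-projection of an M-ideal gives an
extreme functional on the M-ideal. -/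
theorem IsLprojection.domRestrict_mem_extremePoints {M : Submodule ℝ E}
    {P : StrongDual ℝ E →L[ℝ] StrongDual ℝ E} (hP : IsLprojection (StrongDual ℝ E) P)
    (hrange : Set.range P = {f : StrongDual ℝ E | ∀ m ∈ M, f m = 0})
    {f : StrongDual ℝ E} (hf : f ∈ (Metric.closedBall (0 : StrongDual ℝ E) 1).extremePoints ℝ)
    (hf1 : ‖f‖ = 1) (hPf : P f = 0) :
    f.comp M.subtypeL ∈ (Metric.closedBall (0 : StrongDual ℝ M) 1).extremePoints ℝ := by
  constructor
  · refine StrongDual.mem_closedBall_zero_one.2 <|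
      ContinuousLinearMap.opNorm_le_bound _ zero_le_one fun m => ?_
    exact f.le_of_opNorm_le hf1.le (m : E)
  · rintro a ha b hb ⟨s, t, hs, ht, hst, hab⟩
    obtain ⟨a', haa', han⟩ := exists_extension_norm_eq M a
    obtain ⟨b', hbb', hbn⟩ := exists_extension_norm_eq M b
    have ha' : a' ∈ Metric.closedBall (0 : StrongDual ℝ E) 1 := 
      StrongDual.mem_closedBall_zero_one.2 (han.trans_le (StrongDual.mem_closedBall_zero_one.1 ha))
    have hb' : b' ∈ Metric.closedBall (0 : StrongDual ℝ E) 1 := 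
      StrongDual.mem_closedBall_zero_one.2 (hbn.trans_le (StrongDual.mem_closedBall_zero_one.1 hb))
    -- The combination of norm-preserving extensions agrees with `f` on `M` and has norm at most
    -- `1`, so uniqueness applies.
    have hcomb : s • a' + t • b' = f := by
      refine hP.eq_of_eqOn hrange hPf ?_ fun m hm => ?_
      · rw [hf1]
        simpa using convex_closedBall (0 : StrongDual ℝ E) 1 ha' hb' hs.le ht.le hst
      · have h1 := DFunLike.congr_fun hab ⟨m, hm⟩
        have h2 := haa' ⟨m, hm⟩
        have h3 := hbb' ⟨m, hm⟩
        simp only [add_apply, smul_apply] at h1 ⊢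
        rw [h2, h3]
        exact h1
    have := hf.2 ha' hb' ⟨s, t, hs, ht, hst, hcomb⟩
    ext m
    rw [← haa' m, this]
    rfl

end MIdeal

/-! ### Dimension of a sum of independent images. -/

section IndependentImages

variable {ι D W : Type*} [Fintype ι] [AddCommGroup D] [Module ℝ D] [AddCommGroup W] [Module ℝ W]

theorem iSup_map_eq_range (g : ι → D →ₗ[ℝ] W) (V : ι → Submodule ℝ D) :
    ⨆ i, (V i).map (g i) =
      LinearMap.range (∑ i, (g i).comp ((V i).subtype.comp (LinearMap.proj i))) := by
  classical
  refine le_antisymm (iSup_le fun i => ?_) ?_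
  · rintro _ ⟨y, hy, rfl⟩
    refine ⟨Pi.single i ⟨y, hy⟩, ?_⟩
    rw [LinearMap.sum_apply, Finset.sum_eq_single i]
    · simp
    · intro j _ hj
      simp [Pi.single_eq_of_ne hj]
    · simp
  · rintro _ ⟨v, rfl⟩
    rw [LinearMap.sum_apply]
    exact Submodule.sum_mem _ fun i _ =>
      Submodule.mem_iSup_of_mem i (Submodule.mem_map_of_mem (v i).2)

theorem finiteDimensional_iSup_map (g : ι → D →ₗ[ℝ] W) {V : ι → Submodule ℝ D} {m : ι → ℕ}
    (hm : ∀ i, Module.rank ℝ (V i) = m i) :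
    FiniteDimensional ℝ (⨆ i, (V i).map (g i) : Submodule ℝ W) := by
  have hfin : ∀ i, FiniteDimensional ℝ (V i) := fun i =>
    finiteDimensional_of_rank_eq_natCast (hm i)
  infer_instance

/-- The rank of a sum of images of finite-dimensional subspaces under jointly injective maps. -/
theorem rank_iSup_map {g : ι → D →ₗ[ℝ] W} (hg : ∀ v : ι → D, ∑ i, g i (v i) = 0 → v = 0)
    {V : ι → Submodule ℝ D} {m : ι → ℕ} (hm : ∀ i, Module.rank ℝ (V i) = m i) :
    Module.rank ℝ (⨆ i, (V i).map (g i) : Submodule ℝ W) = (∑ i, m i : ℕ) := by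
  have hfin : ∀ i, FiniteDimensional ℝ (V i) := fun i =>
    finiteDimensional_of_rank_eq_natCast (hm i)
  rw [iSup_map_eq_range, ← Module.finrank_eq_rank, LinearMap.finrank_range_of_inj,
    Module.finrank_pi_fintype]
  · exact congrArg _ (Finset.sum_congr rfl fun i _ => Module.finrank_eq_of_rank_eq (hm i))
  · refine (injective_iff_map_eq_zero _).2 fun v hv => funext fun i => Subtype.ext ?_
    exact congrFun (hg (fun i => v i) (by simpa using hv)) i

end IndependentImages

/-! ### Point functionals and extreme support functionals. -/

section PointFunctional

variable {X Y : Type*} [NormedAddCommGroup X] [NormedSpace ℝ X]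
  [NormedAddCommGroup Y] [NormedSpace ℝ Y]

/-- The functional `S ↦ y (S x)` on bounded operators, linearly in `y`. -/
noncomputable def pointFunctional (x : X) :
    StrongDual ℝ Y →ₗ[ℝ] StrongDual ℝ (X →L[ℝ] Y) where
  toFun y := y.comp (ContinuousLinearMap.apply ℝ Y x)
  map_add' _ _ := rfl
  map_smul' _ _ := rfl

@[simp]
theorem pointFunctional_apply (x : X) (y : StrongDual ℝ Y) (S : X →L[ℝ] Y) :
    pointFunctional x y S = y (S x) :=
  rfl

theorem norm_pointFunctional_le (x : X) (y : StrongDual ℝ Y) :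
    ‖pointFunctional x y‖ ≤ ‖y‖ * ‖x‖ := by
  refine ContinuousLinearMap.opNorm_le_bound _ (by positivity) fun S => ?_
  calc ‖y (S x)‖ ≤ ‖y‖ * (‖S‖ * ‖x‖) := y.le_of_opNorm_le_of_le le_rfl (S.le_opNorm x)
    _ = ‖y‖ * ‖x‖ * ‖S‖ := by ring

theorem pointFunctional_mem_supportFunctionals {T : X →L[ℝ] Y} (hT : ‖T‖ = 1) {x : X}
    (hx : ‖x‖ ≤ 1) {y : StrongDual ℝ Y} (hy : y ∈ supportFunctionals (T x)) :
    pointFunctional x y ∈ supportFunctionals T := by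
  rw [mem_supportFunctionals_iff hT.le]
  refine ⟨(norm_pointFunctional_le x y).trans ?_, hy.2⟩
  rw [hy.1, one_mul]
  exact hx

/-- Rank-one operators `ξ ⊗ v` with `y v ≠ 0` reduce this to functionals `ξ` separating points of
`X`. -/
theorem eq_of_pointFunctional_eq {a b : X} {y : StrongDual ℝ Y} (hy : y ≠ 0)
    (h : pointFunctional a y = pointFunctional b y) : a = b := by
  obtain ⟨v, hv⟩ : ∃ v, y v ≠ 0 := by
    by_contra! hv
    exact hy (ContinuousLinearMap.ext hv)
  refine (SeparatingDual.eq_iff_forall_dual_eq (R := ℝ)).2 fun ξ => ?_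
  have := DFunLike.congr_fun h (ξ.smulRight v)
  simpa [hv] using this

/-- If the compact operators form an M-ideal, `X` is reflexive and `T` is at distance less than one
from the compact operators, then every extreme support functional of `T` is `S ↦ y (S x)` with `x`
an extreme point of the unit ball at which `T` attains its norm. -/
theorem exists_pointFunctional_eq_of_mem_extremePoints_supportFunctionals
    (hX : IsReflexiveSpace X) (hK : IsMIdeal (compactOperators X Y)) {T : X →L[ℝ] Y}
    (hT : ‖T‖ = 1)
    (hdist : Metric.infDist T (compactOperators X Y : Set (X →L[ℝ] Y)) < 1)
    {f : StrongDual ℝ (X →L[ℝ] Y)} (hf : f ∈ (supportFunctionals T).extremePoints ℝ) :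
    ∃ x ∈ normAttainmentSet T ∩ Set.extremePoints ℝ (Metric.closedBall (0 : X) 1),
      ∃ y ∈ supportFunctionals (T x), f = pointFunctional x y := by
  obtain ⟨P, hP, hrange⟩ := hK
  have hf1 : ‖f‖ = 1 := hf.1.1
  have hfT : f T = 1 := hf.1.2
  have hext := extremePoints_supportFunctionals_subset hT.le hf
  have hPf : P f = 0 := by
    refine (hP.apply_eq_zero_or_eq_self hext hf1).resolve_right fun hPf => ?_
    have hann : f ∈ Set.range P := ⟨f, hPf⟩
    rw [hrange] at hann
    obtain ⟨k, hk, hTk⟩ := (Metric.infDist_lt_iff ⟨0, zero_mem _⟩).1 hdist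
    have h1 : f (T - k) = 1 := by rw [map_sub, hann k hk, hfT, sub_zero]
    have h2 := f.le_opNorm (T - k)
    rw [h1, hf1, one_mul, norm_one, ← dist_eq_norm] at h2
    linarith
  obtain ⟨x, y, hx, hy, hxy⟩ := exists_eq_of_mem_extremePoints_dual_of_isCompactOperator hX
    (j := (compactOperators X Y).subtypeₗᵢ) (fun k => k.2)
    (hP.domRestrict_mem_extremePoints hrange hext hf1 hPf)
  have hnorm : ‖pointFunctional x y‖ ≤ 1 :=
    (norm_pointFunctional_le x y).trans (mul_le_one₀ hy (norm_nonneg _) hx)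
  have hfeq : pointFunctional x y = f :=
    hP.eq_of_eqOn hrange hPf (hf1.symm ▸ hnorm) fun k hk => (hxy ⟨k, hk⟩).symm
  have hyT : y (T x) = 1 := by rw [← pointFunctional_apply, hfeq, hfT]
  have hy0 : y ≠ 0 := by
    rintro rfl
    simp at hyT
  have hTx : ‖T x‖ ≤ ‖x‖ := by simpa [hT] using T.le_opNorm x
  have hyTx : 1 ≤ ‖T x‖ := by
    have := y.le_of_opNorm_le hy (T x)
    rwa [hyT, norm_one, one_mul] at this
  refine ⟨x, ⟨⟨by linarith, by linarith⟩, by simpa using hx, ?_⟩, y,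
    (mem_supportFunctionals_iff (hTx.trans hx)).2 ⟨hy, hyT⟩, hfeq.symm⟩
  rintro a ha b hb ⟨s, t, hs, ht, hst, rfl⟩
  -- The linear map `c ↦ pointFunctional c y` sends ball to ball and is injective, so extremality of
  -- `f` pulls back to `x`.
  have hball : ∀ c ∈ Metric.closedBall (0 : X) 1,
      pointFunctional c y ∈ Metric.closedBall (0 : StrongDual ℝ (X →L[ℝ] Y)) 1 := fun c hc => by
    exact StrongDual.mem_closedBall_zero_one.2 ((norm_pointFunctional_le c y).trans
      (mul_le_one₀ hy (norm_nonneg _) (mem_closedBall_zero_iff.1 hc)))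
  refine eq_of_pointFunctional_eq hy0 ?_
  rw [hfeq]
  refine hext.2 (hball a ha) (hball b hb) ⟨s, t, hs, ht, hst, ?_⟩
  rw [← hfeq]
  ext S
  simp

/-- A linearly independent finite family in a normed space has a biorthogonal family of continuous
functionals. -/
theorem LinearIndependent.exists_strongDual_apply_eq {ι : Type*} [Finite ι] [DecidableEq ι]
    {x : ι → X} (hx : LinearIndependent ℝ x) (j : ι) :
    ∃ ξ : StrongDual ℝ X, ∀ i, ξ (x i) = if i = j then 1 else 0 := by
  have : FiniteDimensional ℝ (Submodule.span ℝ (Set.range x)) :=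
    FiniteDimensional.span_of_finite ℝ (Set.finite_range x)
  obtain ⟨ξ, hξ, -⟩ := exists_extension_norm_eq (Submodule.span ℝ (Set.range x))
    (LinearMap.toContinuousLinearMap ((Finsupp.lapply j).comp hx.repr))
  refine ⟨ξ, fun i => ?_⟩
  have := hξ ⟨x i, Submodule.subset_span ⟨i, rfl⟩⟩
  rw [this]
  change hx.repr _ j = _
  rw [hx.repr_eq_single i ⟨x i, Submodule.subset_span ⟨i, rfl⟩⟩ rfl, Finsupp.single_apply]

theorem LinearIndependent.eq_zero_of_sum_pointFunctional_eq_zero {ι : Type*} [Fintype ι]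
    {x : ι → X} (hx : LinearIndependent ℝ x) (v : ι → StrongDual ℝ Y)
    (hv : ∑ i, pointFunctional (x i) (v i) = 0) : v = 0 := by
  classical
  ext j w
  obtain ⟨ξ, hξ⟩ := hx.exists_strongDual_apply_eq j
  have := DFunLike.congr_fun hv (ξ.smulRight w)
  simpa [hξ, apply_ite] using this

end PointFunctional

/-! ### The smoothness count. -/

theorem mainTheorem4 {X Y : Type*}
    [NormedAddCommGroup X] [NormedSpace ℝ X] [CompleteSpace X]
    [NormedAddCommGroup Y] [NormedSpace ℝ Y] [CompleteSpace Y]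
    (hX : IsReflexiveSpace X)
    (hK : IsMIdeal (compactOperators X Y))
    (T : X →L[ℝ] Y) (hT : ‖T‖ = 1)
    (hdist : Metric.infDist T (compactOperators X Y : Set (X →L[ℝ] Y)) < 1)
    (r : ℕ) (x : Fin r → X) (hx : LinearIndependent ℝ x)
    (hM : normAttainmentSet T ∩ Set.extremePoints ℝ (Metric.closedBall (0 : X) 1) =
      Set.range x ∪ Set.range (fun i => -x i))
    (m : Fin r → ℕ) (hm : ∀ i, IsKSmooth (m i) (T (x i))) :
    IsKSmooth (∑ i, m i) T := by
  refine ⟨hT, ?_⟩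
  have hx1 : ∀ i, ‖x i‖ = 1 := fun i => by
    have : x i ∈ normAttainmentSet T ∩ Set.extremePoints ℝ (Metric.closedBall (0 : X) 1) := by
      rw [hM]
      exact Or.inl ⟨i, rfl⟩
    exact this.1.1
  have hmem : ∀ i, ∀ y ∈ supportFunctionals (T (x i)), pointFunctional (x i) y ∈
      ⨆ i, (Submodule.span ℝ (supportFunctionals (T (x i)))).map (pointFunctional (x i)) :=
    fun i y hy => Submodule.mem_iSup_of_mem i
      (Submodule.mem_map_of_mem (Submodule.subset_span hy))
  have hspan : Submodule.span ℝ (supportFunctionals T) =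
      ⨆ i, (Submodule.span ℝ (supportFunctionals (T (x i)))).map (pointFunctional (x i)) := by
    refine le_antisymm (Submodule.span_le.2 ?_) (iSup_le fun i => ?_)
    · have := finiteDimensional_iSup_map (fun i => pointFunctional (Y := Y) (x i))
        (fun i => (hm i).2)
      refine subset_of_extremePoints_subset_of_finiteDimensional
        (isCompact_supportFunctionals hT) (convex_supportFunctionals hT.le) _ fun f hf => ?_
      obtain ⟨z, hz, y, hy, rfl⟩ :=
        exists_pointFunctional_eq_of_mem_extremePoints_supportFunctionals hX hK hT hdist hf
      rw [hM] at hz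
      rcases hz with ⟨i, rfl⟩ | ⟨i, rfl⟩
      · exact hmem i y hy
      -- The sign of `-x i` is moved onto `y`, so antipodal points contribute the same subspace.
      · have hy' : -y ∈ supportFunctionals (T (x i)) :=
          ⟨by rw [norm_neg, hy.1], by simpa using hy.2⟩
        have heq : pointFunctional (-x i) y = pointFunctional (x i) (-y) := by
          ext S
          simp
        rw [heq]
        exact hmem i _ hy'
    · rw [Submodule.map_span, Submodule.span_le]
      rintro _ ⟨y, hy, rfl⟩
      exact Submodule.subset_span (pointFunctional_mem_supportFunctionals hT (hx1 i).le hy)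
  rw [hspan]
  exact rank_iSup_map (g := fun i => pointFunctional (Y := Y) (x i))
    (fun v hv => hx.eq_zero_of_sum_pointFunctional_eq_zero v hv) fun i => (hm i).2
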